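/- Throughout, $A$, $B$, $C$ are irreducible square matrices of size greater than $1$ with entries in $\{0,1\}$ satisfying condition (I) of Cuntz--Krieger. Let $X_A=\{(x_n)_{n\ge 1} : A(x_n,x_{n+1})=1 \text{ for all } n\}$ with the product topology, and let $\sigma_A$ be the shift on $X_A$. A continuous orbit map $h:(X_A,\sigma_A)\to(X_B,\sigma_B)$ is a local homeomorphism $h:X_A\to X_B$ for which there are continuous functions $k_1,l_1:X_A\to\mathbb{Z}_{\ge 0}$ with $\sigma_B^{k_1(x)}(h(\sigma_A(x)))=\sigma_B^{l_1(x)}(h(x))$ for all $x\in X_A$. For $f\in C(X_B,\mathbb{Z})$ put $$\Psi_h(f)(x)=\sum_{i=0}^{l_1(x)-1}f(\sigma_B^i(h(x)))-\sum_{j=0}^{k_1(x)-1}f(\sigma_B^j(h(\sigma_A(x)))),\qquad x\in X_A .$$ Let $\mathrm{cobdy}(\sigma_A)=\{\xi-\xi\circ\sigma_A : \xi\in C(X_A,\mathbb{Z})\}$, $H^A=C(X_A,\mathbb{Z})/\mathrm{cobdy}(\sigma_A)$, and let $H^A_+$ be the set of classes of nonnegative functions; $(H^A,H^A_+)$ is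 an ordered abelian group. Let $h:(X_A,\sigma_A)\to(X_B,\sigma_B)$ and $g:(X_B,\sigma_B)\to(X_C,\sigma_C)$ be continuous orbit maps. Then the homomorphism $\Psi_h:C(X_B,\mathbb{Z})\to C(X_A,\mathbb{Z})$ does not depend on the choice of $k_1,l_1$ (and likewise $\Psi_g$), and (i) $\Psi_h\circ\Psi_g=\Psi_{g\circ h}$. (ii) $\Psi_h(\mathrm{cobdy}(\sigma_B))\subset\mathrm{cobdy}(\sigma_A)$ and $\Psi_g(\mathrm{cobdy}(\sigma_C))\subset\mathrm{cobdy}(\sigma_B)$. (iii) The induced homomorphisms $\bar\Psi_h:H^B\to H^A$ and $\bar\Psi_g:H^C\to H^B$ satisfy $\bar\Psi_h(H^B_+)\subset H^A_+$ and $\bar\Psi_g(H^C_+)\subset H^B_+$, and $\bar\Psi_h\circ\bar\Psi_g=\bar\Psi_{g\circ h}$. Consequently $(X_A,\sigma_A)\mapsto(H^A,H^A_+)$, $h\mapsto\bar\Psi_h$ is a contravariant functor from the category of these shifts, with continuous orbit maps as morphisms, to the category of ordered abelian groups with positive homomorphisms. If $h$ is a homeomorphism such that $h$ and $h^{-1}$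 are both continuous orbit maps, then $\bar\Psi_h$ is an isomorphism of ordered groups with inverse $\bar\Psi_{h^{-1}}$. Hence the functor descends to the category whose objects are the continuous orbit equivalence classes $[(X_A,\sigma_A)]$ and whose morphisms are the continuous orbit maps between (fixed) representatives, and its value at $[(X_A,\sigma_A)]$ is isomorphic to $(H^A,H^A_+)$. -/

import Mathlib

open CategoryTheory

/-- Condition (I) of Cuntz and Krieger: every state is connected by an admissible path to a state
`j` at which there are two different first-return loops. The loop `j, w₁, …, wᵣ, j` is recorded by
its list `w` of interior states, all of which are different from `j`. -/
def ConditionI {N : ℕ} (M : Matrix (Fin N) (Fin N) ℤ) : Prop :=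
  ∀ i : Fin N, ∃ j : Fin N, Relation.ReflTransGen (fun a b => M a b = 1) i j ∧
    ∃ w w' : List (Fin N), w ≠ w' ∧ j ∉ w ∧ j ∉ w' ∧
      List.IsChain (fun a b => M a b = 1) (j :: (w ++ [j])) ∧
      List.IsChain (fun a b => M a b = 1) (j :: (w' ++ [j]))

/-- The matrices defining one-sided topological Markov shifts: irreducible `{0,1}`-matrices of
size `N > 1` with condition (I). -/
structure MarkovShift where
  N : ℕ
  one_lt : 1 < N
  mat : Matrix (Fin N) (Fin N) ℤ
  zero_or_one : ∀ i j, mat i j = 0 ∨ mat i j = 1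
  irreducible : mat.IsIrreducible
  conditionI : ConditionI mat

namespace MarkovShift

/-- The one-sided shift space `X_A`, with the topology induced by the product topology. -/
abbrev X (A : MarkovShift) : Type :=
  {x : ℕ → Fin A.N // ∀ n, A.mat (x n) (x (n + 1)) = 1}

/-- The shift `σ_A : X_A → X_A`. -/
def σ (A : MarkovShift) : C(A.X, A.X) where
  toFun x := ⟨fun n => x.1 (n + 1), fun n => x.2 (n + 1)⟩
  continuous_toFun := by
    refine Continuous.subtype_mk (continuous_pi fun n => ?_) _
    exact (continuous_apply (n + 1)).comp continuous_subtype_val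

lemma σ_iterate (A : MarkovShift) (n : ℕ) (x : A.X) (m : ℕ) :
    ((A.σ)^[n] x).1 m = x.1 (m + n) := by
  induction n generalizing m with
  | zero => rfl
  | succ n ih =>
    rw [Function.iterate_succ_apply']
    change ((A.σ)^[n] x).1 (m + 1) = _
    rw [ih, add_right_comm]; rfl

end MarkovShift

/-- `σ_B^{k(x)} (h (σ_A x)) = σ_B^{l(x)} (h x)` for all `x ∈ X_A`. -/
def OrbitEq {A B : MarkovShift} (h : A.X → B.X) (k l : C(A.X, ℕ)) : Prop :=
  ∀ x, (B.σ)^[k x] (h (A.σ x)) = (B.σ)^[l x] (h x)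

/-- Continuous orbit maps `(X_A, σ_A) → (X_B, σ_B)`, as a property of maps. -/
def IsContOrbitMap {A B : MarkovShift} (h : A.X → B.X) : Prop :=
  IsLocalHomeomorph h ∧ ∃ k l : C(A.X, ℕ), OrbitEq h k l

/-- Continuous orbit maps `h : (X_A, σ_A) → (X_B, σ_B)`. -/
@[ext]
structure ContOrbitMap (A B : MarkovShift) where
  toFun : A.X → B.X
  isContOrbitMap : IsContOrbitMap toFun

/-- Continuous orbit equivalence: there is a homeomorphism which is, together with its inverse,
a continuous orbit map. -/
def ContOrbitEquiv (A B : MarkovShift) : Prop :=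
  ∃ e : A.X ≃ₜ B.X, IsContOrbitMap e ∧ IsContOrbitMap e.symm

section Composition

variable {A B C : MarkovShift}

/-- `k^n(x) = ∑_{i<n} k(σ^i x)`. -/
def birkhoff (k : C(A.X, ℕ)) (n : ℕ) (x : A.X) : ℕ :=
  ∑ i ∈ Finset.range n, k ((A.σ)^[i] x)

lemma OrbitEq.iterate {h : A.X → B.X} {k l : C(A.X, ℕ)} (hkl : OrbitEq h k l) (n : ℕ) (x : A.X) :
    (B.σ)^[birkhoff k n x] (h ((A.σ)^[n] x)) = (B.σ)^[birkhoff l n x] (h x) := by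
  induction n with
  | zero => simp [birkhoff]
  | succ n ih =>
    have h1 : birkhoff k (n + 1) x = birkhoff k n x + k ((A.σ)^[n] x) :=
      Finset.sum_range_succ (fun i => k ((A.σ)^[i] x)) n
    have h2 : birkhoff l (n + 1) x = l ((A.σ)^[n] x) + birkhoff l n x := by
      rw [add_comm (l _)]; exact Finset.sum_range_succ (fun i => l ((A.σ)^[i] x)) n
    rw [h1, h2, Function.iterate_add_apply, Function.iterate_succ_apply', hkl,
      ← Function.iterate_add_apply, add_comm, Function.iterate_add_apply, ih,
      ← Function.iterate_add_apply]

lemma continuous_iterate_nat (l : C(A.X, ℕ))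
    {Y : Type*} [TopologicalSpace Y] (F : ℕ → A.X → Y) (hF : ∀ n, Continuous (F n)) :
    Continuous fun x => F (l x) x := by
  rw [continuous_iff_continuousAt]
  intro x
  have hx : ∀ᶠ y in nhds x, F (l y) y = F (l x) y := by
    have : ∀ᶠ y in nhds x, l y = l x :=
      l.continuous.continuousAt.eventually
        (p := fun m => m = l x) (IsOpen.mem_nhds (isOpen_discrete {l x}) rfl)
    filter_upwards [this] with y hy
    rw [hy]
  exact ((hF (l x)).continuousAt).congr (hx.mono fun _ hy => hy.symm)

lemma continuous_birkhoff (k : C(B.X, ℕ)) (n : ℕ) : Continuous (birkhoff k n) := by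
  unfold birkhoff
  exact continuous_finsetSum _ fun i _ => k.continuous.comp (B.σ.continuous.iterate i)

lemma IsContOrbitMap.id : IsContOrbitMap (id : A.X → A.X) :=
  ⟨(Homeomorph.refl A.X).isLocalHomeomorph, ContinuousMap.const _ 0, ContinuousMap.const _ 1,
    fun _ => rfl⟩

lemma IsContOrbitMap.comp {g : B.X → C.X} {h : A.X → B.X} (hg : IsContOrbitMap g)
    (hh : IsContOrbitMap h) : IsContOrbitMap (g ∘ h) := by
  obtain ⟨hg, k₂, l₂, h₂⟩ := hg
  obtain ⟨hh, k₁, l₁, h₁⟩ := hh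
  have c1 : Continuous h := hh.continuous
  have c2 : Continuous fun x => h (A.σ x) := c1.comp A.σ.continuous
  refine ⟨hg.comp hh,
    ⟨fun x => birkhoff k₂ (l₁ x) (h x) + birkhoff l₂ (k₁ x) (h (A.σ x)), ?_⟩,
    ⟨fun x => birkhoff l₂ (l₁ x) (h x) + birkhoff k₂ (k₁ x) (h (A.σ x)), ?_⟩, ?_⟩
  · exact (continuous_iterate_nat l₁ (fun n x => birkhoff k₂ n (h x))
        fun n => (continuous_birkhoff k₂ n).comp c1).add
      (continuous_iterate_nat k₁ (fun n x => birkhoff l₂ n (h (A.σ x)))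
        fun n => (continuous_birkhoff l₂ n).comp c2)
  · exact (continuous_iterate_nat l₁ (fun n x => birkhoff l₂ n (h x))
        fun n => (continuous_birkhoff l₂ n).comp c1).add
      (continuous_iterate_nat k₁ (fun n x => birkhoff k₂ n (h (A.σ x)))
        fun n => (continuous_birkhoff k₂ n).comp c2)
  · intro x
    have e1 := h₂.iterate (l₁ x) (h x)
    have e2 := h₂.iterate (k₁ x) (h (A.σ x))
    rw [h₁ x] at e2
    simp only [ContinuousMap.coe_mk, Function.comp_apply]
    rw [Function.iterate_add_apply, ← e2, ← Function.iterate_add_apply, add_comm,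
      Function.iterate_add_apply, e1, ← Function.iterate_add_apply, add_comm]

end Composition

namespace ContOrbitMap

variable {A B C : MarkovShift}

/-- The identity of `X_A` as a continuous orbit map. -/
def id (A : MarkovShift) : ContOrbitMap A A := ⟨fun x => x, IsContOrbitMap.id⟩

/-- The composition `g ∘ h` of continuous orbit maps. -/
def comp (g : ContOrbitMap B C) (h : ContOrbitMap A B) : ContOrbitMap A C :=
  ⟨g.toFun ∘ h.toFun, g.isContOrbitMap.comp h.isContOrbitMap⟩

lemma continuous (h : ContOrbitMap A B) : Continuous h.toFun := h.isContOrbitMap.1.continuous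

/-- Some functions `k`, `l` as in the definition of a continuous orbit map. -/
noncomputable def k (h : ContOrbitMap A B) : C(A.X, ℕ) := h.isContOrbitMap.2.choose

/-- The function `l` belonging to `h.k`. -/
noncomputable def l (h : ContOrbitMap A B) : C(A.X, ℕ) := h.isContOrbitMap.2.choose_spec.choose

lemma orbitEq (h : ContOrbitMap A B) : OrbitEq h.toFun h.k h.l :=
  h.isContOrbitMap.2.choose_spec.choose_spec

end ContOrbitMap

/-- The category with the one-sided topological Markov shifts as objects and the continuous orbit
maps as morphisms. -/
instance : Category MarkovShift where
  Hom := ContOrbitMap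
  id := ContOrbitMap.id
  comp h g := g.comp h

lemma contOrbitEquiv_equivalence : Equivalence ContOrbitEquiv where
  refl A := ⟨Homeomorph.refl _, IsContOrbitMap.id, IsContOrbitMap.id⟩
  symm := fun ⟨e, h, h'⟩ => ⟨e.symm, h', h⟩
  trans := fun ⟨e, h, h'⟩ ⟨e₂, g, g'⟩ => ⟨e.trans e₂, g.comp h, h'.comp g'⟩

/-- The setoid of continuous orbit equivalence. -/
def coeSetoid : Setoid MarkovShift := ⟨ContOrbitEquiv, contOrbitEquiv_equivalence⟩

/-- The continuous orbit equivalence classes `[(X_A, σ_A)]` of one-sided topological Markov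
shifts. -/
def COEClass : Type := Quotient coeSetoid

/-- A representative of a continuous orbit equivalence class. -/
noncomputable def COEClass.rep (c : COEClass) : MarkovShift := Quotient.out c

/-- The continuous orbit equivalence class of a shift. -/
def COEClass.mk (A : MarkovShift) : COEClass := Quotient.mk coeSetoid A

/-- The category of continuous orbit equivalence classes; a morphism between two classes is a
continuous orbit map between their representatives. -/
noncomputable instance : Category COEClass where
  Hom c d := ContOrbitMap c.rep d.rep
  id c := ContOrbitMap.id c.rep
  comp h g := ContOrbitMap.comp g h

/-- The homomorphism `ξ ↦ ξ - ξ ∘ σ_A` on `C(X_A, ℤ)`. -/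
def coboundary (A : MarkovShift) : C(A.X, ℤ) →+ C(A.X, ℤ) where
  toFun ξ := ξ - ξ.comp A.σ
  map_zero' := by ext; simp
  map_add' ξ η := by ext; simp; ring

/-- The group `cobdy(σ_A) = {ξ - ξ ∘ σ_A}` of coboundaries. -/
def cobdy (A : MarkovShift) : AddSubgroup C(A.X, ℤ) := (coboundary A).range

/-- The group `H^A = C(X_A, ℤ) / cobdy(σ_A)`. -/
abbrev H (A : MarkovShift) : Type := C(A.X, ℤ) ⧸ cobdy A

/-- The class `[f]` in `H^A`. -/
abbrev H.mk (A : MarkovShift) : C(A.X, ℤ) →+ H A := QuotientAddGroup.mk' (cobdy A)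

section Recurrence

variable (A : MarkovShift)

lemma MarkovShift.exists_cons (a : Fin A.N) (x : A.X) (h : A.mat a (x.1 0) = 1) :
    ∃ y : A.X, y.1 0 = a ∧ A.σ y = x := by
  refine ⟨⟨fun n => Nat.casesOn n a x.1, ?_⟩, rfl, rfl⟩
  intro n
  cases n with
  | zero => exact h
  | succ n => exact x.2 n

lemma MarkovShift.exists_path (a b : Fin A.N)
    (p : @Quiver.Path _ (Matrix.toQuiver A.mat) a b) (x : A.X) (hx : x.1 0 = b) :
    ∃ y : A.X, y.1 0 = a ∧
      (A.σ)^[@Quiver.Path.length _ (Matrix.toQuiver A.mat) a b p] y = x := by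
  let := Matrix.toQuiver A.mat
  induction p generalizing x with
  | nil => exact ⟨x, hx, rfl⟩
  | @cons c d p e ih =>
    have hcd : A.mat c (x.1 0) = 1 := by
      have := e.down
      rcases A.zero_or_one c d with h | h
      · omega
      · rw [hx]; exact h
    obtain ⟨y, hy, hyx⟩ := A.exists_cons c x hcd
    obtain ⟨z, hz, hzy⟩ := ih y hy
    refine ⟨z, hz, ?_⟩
    rw [Quiver.Path.length_cons, Function.iterate_succ_apply', hzy, hyx]

lemma MarkovShift.exists_prefix (m : ℕ) (x y : A.X) (h : y.1 0 = x.1 m) :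
    ∃ z : A.X, (∀ i ≤ m, z.1 i = x.1 i) ∧ (A.σ)^[m] z = y := by
  induction m generalizing y with
  | zero => exact ⟨y, fun i hi => by obtain rfl : i = 0 := by omega
                                     exact h, rfl⟩
  | succ m ih =>
    obtain ⟨y', h1, h2⟩ := A.exists_cons (x.1 m) y (by rw [h]; exact x.2 m)
    obtain ⟨z, hz, hzy⟩ := ih y' h1
    refine ⟨z, ?_, by rw [Function.iterate_succ_apply', hzy, h2]⟩
    intro i hi
    rcases Nat.lt_or_ge i (m + 1) with h' | h'
    · exact hz i (by omega)
    · obtain rfl : i = m + 1 := by omega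
      have := A.σ_iterate m z 1
      rw [hzy, add_comm] at this
      rw [← this, ← h, ← h2]
      rfl

/-- Every neighbourhood of a point of `X_A` contains a point that returns to it. -/
lemma MarkovShift.exists_return (x : A.X) (U : Set A.X) (hU : U ∈ nhds x) :
    ∃ y ∈ U, ∃ n, 0 < n ∧ (A.σ)^[n] y ∈ U := by
  obtain ⟨m, hm⟩ : ∃ m : ℕ, ∀ y : A.X, (∀ i ≤ m, y.1 i = x.1 i) → y ∈ U := by
    rw [nhds_subtype_eq_comap, Filter.mem_comap] at hU
    obtain ⟨V, hV, hVU⟩ := hU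
    rw [nhds_pi, Filter.mem_pi] at hV
    obtain ⟨I, hI, t, ht, htV⟩ := hV
    obtain ⟨m, hm⟩ := hI.bddAbove
    refine ⟨m, fun y hy => hVU (htV ?_)⟩
    intro i hi
    rw [hy i (hm hi)]
    exact mem_of_mem_nhds (ht i)
  obtain ⟨p, hp⟩ := A.irreducible.connected (x.1 m) (x.1 0)
  obtain ⟨y, hy, hyx⟩ := A.exists_path _ _ p x rfl
  obtain ⟨z, hz, hzy⟩ := A.exists_prefix m x y hy
  refine ⟨z, hm z hz, _, Nat.add_pos_left hp m, ?_⟩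
  rw [Function.iterate_add_apply, hzy, hyx]
  exact mem_of_mem_nhds hU

/-- A nonnegative coboundary vanishes. -/
lemma eq_zero_of_nonneg_coboundary (F ξ : C(A.X, ℤ)) (hF : 0 ≤ F) (h : coboundary A ξ = F) :
    F = 0 := by
  have hx : ∀ x, F x = ξ x - ξ (A.σ x) := fun x => by rw [← h]; rfl
  have hmono : ∀ (n : ℕ) x, ξ ((A.σ)^[n] x) ≤ ξ x := by
    intro n
    induction n with
    | zero => intro x; exact le_rfl
    | succ n ih =>
      intro x
      rw [Function.iterate_succ_apply]
      have h1 := ih (A.σ x)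
      have h2 := hx x
      have h3 : (0 : ℤ) ≤ F x := hF x
      linarith
  ext x
  have hx0 : (0 : ℤ) ≤ F x := hF x
  change F x = 0
  have e1 : ∀ᶠ y in nhds x, ξ y = ξ x :=
    ξ.continuous.continuousAt.eventually (p := fun m => m = ξ x)
      (IsOpen.mem_nhds (isOpen_discrete {ξ x}) rfl)
  have e2 : ∀ᶠ y in nhds x, ξ (A.σ y) = ξ (A.σ x) :=
    (ξ.comp A.σ).continuous.continuousAt.eventually (p := fun m => m = ξ (A.σ x))
      (IsOpen.mem_nhds (isOpen_discrete {ξ (A.σ x)}) rfl)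
  obtain ⟨y, ⟨hy1, hy2⟩, n, hn, hn1, -⟩ := A.exists_return x _ (e1.and e2)
  obtain ⟨n, rfl⟩ : ∃ k, n = k + 1 := ⟨n - 1, by omega⟩
  rw [Function.iterate_succ_apply] at hn1
  have := hmono n (A.σ y)
  have := hx x
  linarith

end Recurrence

/-- The positive cone `H^A_+`: the classes of nonnegative functions. That
`H^A_+ ∩ (-H^A_+) = 0` makes `(H^A, H^A_+)` an ordered abelian group. -/
def HPlus (A : MarkovShift) : AddGroupCone (H A) where
  carrier := {u | ∃ f : C(A.X, ℤ), 0 ≤ f ∧ H.mk A f = u}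
  zero_mem' := ⟨0, le_rfl, map_zero _⟩
  add_mem' := by
    rintro _ _ ⟨f, hf, rfl⟩ ⟨g, hg, rfl⟩
    exact ⟨f + g, fun x => add_nonneg (hf x) (hg x), map_add _ _ _⟩
  eq_zero_of_mem_of_neg_mem' := by
    rintro _ ⟨f, hf, rfl⟩ ⟨g, hg, hgf⟩
    have h0 : H.mk A (f + g) = 0 := by rw [map_add, hgf, add_neg_cancel]
    obtain ⟨ξ, hξ⟩ : f + g ∈ cobdy A := (QuotientAddGroup.eq_zero_iff _).1 h0
    have hz := eq_zero_of_nonneg_coboundary A (f + g) ξ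
      (fun x => add_nonneg (hf x) (hg x)) hξ
    have : f = 0 := by
      ext x
      have h1 : f x + g x = 0 := DFunLike.congr_fun hz x
      have h2 : (0 : ℤ) ≤ f x := hf x
      have h3 : (0 : ℤ) ≤ g x := hg x
      change f x = 0
      linarith
    rw [this, map_zero]

/-- Ordered abelian groups `(G, G_+)`, given by their cones of nonnegative elements. -/
structure OrdAb where
  carrier : Type
  [group : AddCommGroup carrier]
  posCone : AddGroupCone carrier

attribute [instance] OrdAb.group

/-- Homomorphisms of ordered abelian groups: homomorphisms preserving the positive cones. -/
@[ext]
structure OrdAb.Hom (G K : OrdAb) where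
  toHom : G.carrier →+ K.carrier
  map_pos : ∀ u ∈ G.posCone, toHom u ∈ K.posCone

/-- The category `𝒜₊` of ordered abelian groups. -/
instance : Category OrdAb where
  Hom := OrdAb.Hom
  id G := ⟨AddMonoidHom.id _, fun _ h => h⟩
  comp φ ψ := ⟨ψ.toHom.comp φ.toHom, fun _ h => ψ.map_pos _ (φ.map_pos _ h)⟩

/-- The ordered cohomology group `(H^A, H^A_+)`. -/
def orderedH (A : MarkovShift) : OrdAb := ⟨H A, HPlus A⟩

section Psi

variable {A B : MarkovShift}

/-- The cocycle sum
`∑_{i < l(x)} f(σ_B^i(h(x))) - ∑_{j < k(x)} f(σ_B^j(h(σ_A(x))))`. -/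
def cocycleSum (h : A.X → B.X) (k l : C(A.X, ℕ)) (f : C(B.X, ℤ)) (x : A.X) : ℤ :=
  ∑ i ∈ Finset.range (l x), f ((B.σ)^[i] (h x)) -
    ∑ j ∈ Finset.range (k x), f ((B.σ)^[j] (h (A.σ x)))

lemma continuous_cocycleSum (h : A.X → B.X) (hh : Continuous h) (k l : C(A.X, ℕ))
    (f : C(B.X, ℤ)) : Continuous (cocycleSum h k l f) := by
  unfold cocycleSum
  refine Continuous.sub ?_ ?_
  · exact continuous_iterate_nat l
      (fun n x => ∑ i ∈ Finset.range n, f ((B.σ)^[i] (h x))) fun n =>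
      continuous_finsetSum _ fun i _ =>
        f.continuous.comp ((B.σ.continuous.iterate i).comp hh)
  · exact continuous_iterate_nat k
      (fun n x => ∑ i ∈ Finset.range n, f ((B.σ)^[i] (h (A.σ x)))) fun n =>
      continuous_finsetSum _ fun i _ =>
        f.continuous.comp ((B.σ.continuous.iterate i).comp (hh.comp A.σ.continuous))

/-- The homomorphism `Ψ_h : C(X_B, ℤ) → C(X_A, ℤ)`. -/
noncomputable def Psi (h : ContOrbitMap A B) : C(B.X, ℤ) →+ C(A.X, ℤ) where
  toFun f := ⟨cocycleSum h.toFun h.k h.l f, continuous_cocycleSum _ h.continuous _ _ _⟩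
  map_zero' := by ext; simp [cocycleSum]
  map_add' f g := by ext; simp [cocycleSum, Finset.sum_add_distrib]; ring

lemma Psi_coboundary (h : ContOrbitMap A B) (f : C(B.X, ℤ)) :
    Psi h (coboundary B f) = coboundary A (f.comp ⟨h.toFun, h.continuous⟩) := by
  have key : ∀ (n : ℕ) (y : B.X), ∑ i ∈ Finset.range n, (coboundary B f) ((B.σ)^[i] y)
      = f y - f ((B.σ)^[n] y) := by
    intro n y
    refine Eq.trans ?_ (Finset.sum_range_sub' (fun i => f ((B.σ)^[i] y)) n)
    refine Finset.sum_congr rfl fun i _ => ?_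
    rw [Function.iterate_succ_apply']
    rfl
  ext x
  change cocycleSum h.toFun h.k h.l (coboundary B f) x = f (h.toFun x) - f (h.toFun (A.σ x))
  unfold cocycleSum
  rw [key, key, h.orbitEq x]
  ring

lemma cobdy_le_comap_Psi (h : ContOrbitMap A B) : cobdy B ≤ (cobdy A).comap (Psi h) := by
  rintro _ ⟨f, rfl⟩
  exact ⟨_, (Psi_coboundary h f).symm⟩

/-- The homomorphism `Ψ̄_h : H^B → H^A`, `[f] ↦ [Ψ_h f]`. -/
noncomputable def PsiBar (h : ContOrbitMap A B) : H B →+ H A :=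
  QuotientAddGroup.map (cobdy B) (cobdy A) (Psi h) (cobdy_le_comap_Psi h)

end Psi

/-- Positivity of all the homomorphisms `Ψ̄_h`. -/
def PsiBarPositive : Prop :=
  ∀ ⦃A B : MarkovShift⦄ (h : ContOrbitMap A B), ∀ u ∈ HPlus B, PsiBar h u ∈ HPlus A

/-- `Ψ̄_h` as a homomorphism of ordered abelian groups `(H^B, H^B_+) → (H^A, H^A_+)`. -/
noncomputable def psiHom (hpos : PsiBarPositive) {A B : MarkovShift} (h : ContOrbitMap A B) :
    orderedH B ⟶ orderedH A :=
  OrdAb.Hom.mk (G := orderedH B) (K := orderedH A) (PsiBar h) (hpos h)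

/-- The correspondence `(X_A, σ_A) ↦ (H^A, H^A_+)`, `h ↦ Ψ̄_h`, without functor laws. -/
noncomputable def psiCorrespondence (hpos : PsiBarPositive) : MarkovShiftᵒᵖ ⥤q OrdAb where
  obj A := orderedH A.unop
  map h := psiHom hpos h.unop

/-- The correspondence `[(X_A, σ_A)] ↦ (H^A, H^A_+)`, `h ↦ Ψ̄_h` on continuous orbit equivalence
classes, without functor laws. -/
noncomputable def psiClassCorrespondence (hpos : PsiBarPositive) : COEClassᵒᵖ ⥤q OrdAb where
  obj c := orderedH c.unop.rep
  map h := psiHom hpos h.unop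

/-! `Ψ_h f x` is a difference of Birkhoff sums of `f` along the orbits of `h x` and `h (σ_A x)` up
to a point where they meet. It depends only on the lag `l - k` (`birkhoffSum_sub_eq_of_iterate_eq`),
and `h` determines the lag: two lags would make two different powers of `σ_B` agree on a nonempty
open set, which condition (I) excludes (`OrbitEq.lag_unique`). Concatenating meeting orbits
(`birkhoffSum_sub_add`) gives the Birkhoff sums of `Ψ_h f`, hence functoriality.

The hard point is positivity. Around a periodic orbit the lag is strictly positive
(`birkhoff_k_lt_birkhoff_l`): otherwise some neighbourhood of the periodic point would be mapped
into itself by the period and would consist of that point alone, but there are no isolated points.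
So for `f ≥ 0` the periodic sums of `Ψ_h f` are nonnegative. An argument of Livšic type then
applies: closing words up to periodic points bounds all Birkhoff sums below
(`exists_le_birkhoffSum`), and their infimum over backward orbits is a transfer function making `Ψ_h
f` nonnegative (`exists_nonneg_add_coboundary`). -/

namespace MarkovShift

/-! ### Cylinders, consequences of condition (I), and periodic points -/

variable (A : MarkovShift)

lemma ext_coord {x y : A.X} (h : ∀ n, x.1 n = y.1 n) : x = y := Subtype.ext (funext h)

/-- Every neighbourhood of a point contains a cylinder around it. -/
lemma exists_cylinder_subset {x : A.X} {U : Set A.X} (hU : U ∈ nhds x) :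
    ∃ m : ℕ, ∀ y : A.X, (∀ i < m, y.1 i = x.1 i) → y ∈ U := by
  rw [nhds_subtype_eq_comap, Filter.mem_comap] at hU
  obtain ⟨V, hV, hVU⟩ := hU
  rw [nhds_pi, Filter.mem_pi] at hV
  obtain ⟨I, hI, t, ht, htV⟩ := hV
  obtain ⟨m, hm⟩ := hI.bddAbove
  refine ⟨m + 1, fun y hy => hVU (htV ?_)⟩
  intro i hi
  rw [hy i (Nat.lt_succ_of_le (hm hi))]
  exact mem_of_mem_nhds (ht i)

/-- Cylinders are neighbourhoods. -/
lemma eventually_cylinder (x : A.X) (m : ℕ) :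
    ∀ᶠ y : A.X in nhds x, ∀ i < m, y.1 i = x.1 i := by
  have : ∀ᶠ y : A.X in nhds x, ∀ i ∈ Finset.range m, y.1 i = x.1 i := by
    rw [Filter.eventually_all_finset]
    intro i _
    have hc : Continuous fun y : A.X => y.1 i := (continuous_apply i).comp continuous_subtype_val
    exact hc.continuousAt.eventually (p := fun a => a = x.1 i)
      (IsOpen.mem_nhds (isOpen_discrete {x.1 i}) rfl)
  filter_upwards [this] with y hy i hi
  exact hy i (Finset.mem_range.2 hi)

instance : CompactSpace A.X := by
  suffices hcl : IsClosed {x : ℕ → Fin A.N | ∀ n, A.mat (x n) (x (n + 1)) = 1} from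
    isCompact_iff_compactSpace.1 hcl.isCompact
  have : {x : ℕ → Fin A.N | ∀ n, A.mat (x n) (x (n + 1)) = 1} =
      ⋂ n, (fun x : ℕ → Fin A.N => (x n, x (n + 1))) ⁻¹' {p | A.mat p.1 p.2 = 1} := by
    ext x; simp
  rw [this]
  exact isClosed_iInter fun n => (isClosed_discrete _).preimage (by fun_prop)

/-- A continuous integer-valued function depends on finitely many coordinates only. -/
lemma exists_coord_dependence (F : C(A.X, ℤ)) :
    ∃ m : ℕ, ∀ x y : A.X, (∀ i < m, x.1 i = y.1 i) → F x = F y := by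
  have hloc : ∀ x : A.X, ∃ m : ℕ, ∀ y : A.X, (∀ i < m, y.1 i = x.1 i) → F y = F x := fun x =>
    A.exists_cylinder_subset (F.continuous.continuousAt.eventually (p := fun a => a = F x)
      (IsOpen.mem_nhds (isOpen_discrete {F x}) rfl))
  choose m hm using hloc
  obtain ⟨t, ht⟩ := CompactSpace.elim_nhds_subcover
    (fun x => {y : A.X | ∀ i < m x, y.1 i = x.1 i}) (fun x => A.eventually_cylinder x (m x))
  refine ⟨t.sup m, fun x y hxy => ?_⟩
  have hx : x ∈ ⋃ z ∈ t, {y : A.X | ∀ i < m z, y.1 i = z.1 i} := by rw [ht]; trivial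
  simp only [Set.mem_iUnion] at hx
  obtain ⟨z, hz, hxz⟩ := hx
  have hle : m z ≤ t.sup m := Finset.le_sup hz
  rw [hm z x hxz, hm z y fun i hi => (hxy i (hi.trans_le hle)).symm.trans (hxz i hi)]

/-- A function depending on finitely many coordinates only is continuous. -/
lemma continuous_of_coord_dependence (F : A.X → ℤ) (m : ℕ)
    (h : ∀ x y : A.X, (∀ i < m, x.1 i = y.1 i) → F x = F y) : Continuous F := by
  rw [continuous_iff_continuousAt]
  intro x
  refine (continuousAt_const (y := F x)).congr ?_
  filter_upwards [A.eventually_cylinder x m] with y hy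
  exact (h y x hy).symm

lemma exists_point_from (a : Fin A.N) (x : A.X) : ∃ y : A.X, y.1 0 = a := by
  obtain ⟨p, -⟩ := A.irreducible.connected a (x.1 0)
  obtain ⟨y, hy, -⟩ := A.exists_path _ _ p x rfl
  exact ⟨y, hy⟩

/-- An admissible word can be read at the beginning of a point. -/
lemma exists_of_isChain (w : List (Fin A.N)) (a b : Fin A.N)
    (h : List.IsChain (fun a b => A.mat a b = 1) (a :: (w ++ [b]))) (t : A.X) (ht : t.1 0 = b) :
    ∃ z : A.X, z.1 0 = a ∧ (∀ i (hi : i < w.length), z.1 (i + 1) = w[i]) ∧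
      z.1 (w.length + 1) = b := by
  induction w generalizing a with
  | nil =>
    obtain ⟨z, hz, hzt⟩ := A.exists_cons a t (by rw [ht]; simpa using h)
    refine ⟨z, hz, fun i hi => absurd hi (by simp), ?_⟩
    rw [← ht, ← hzt]; rfl
  | cons c w ih =>
    rw [List.cons_append, List.isChain_cons_cons] at h
    obtain ⟨y, hy0, hy, hyb⟩ := ih c h.2
    obtain ⟨z, hz, hzy⟩ := A.exists_cons a y (by rw [hy0]; exact h.1)
    have hs : ∀ n, z.1 (n + 1) = y.1 n := fun n => by rw [← hzy]; rfl
    refine ⟨z, hz, ?_, by rw [hs]; exact hyb⟩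
    intro i hi
    rw [hs]
    cases i with
    | zero => exact hy0
    | succ i => exact hy i _

/-- With loops of different lengths, the shorter one is back at `j` while the longer one is still in
its interior, which avoids `j`. Loops of equal length differ in some letter. -/
lemma exists_ne_of_loops (x : A.X) (j : Fin A.N) (w w' : List (Fin A.N)) (hne : w ≠ w')
    (hj : j ∉ w) (hj' : j ∉ w')
    (hw : List.IsChain (fun a b => A.mat a b = 1) (j :: (w ++ [j])))
    (hw' : List.IsChain (fun a b => A.mat a b = 1) (j :: (w' ++ [j]))) :
    ∃ y y' : A.X, y ≠ y' ∧ y.1 0 = j ∧ y'.1 0 = j := by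
  obtain ⟨t, ht⟩ := A.exists_point_from j x
  obtain ⟨y, hy0, hy, hyj⟩ := A.exists_of_isChain w j j hw t ht
  obtain ⟨y', hy0', hy', hyj'⟩ := A.exists_of_isChain w' j j hw' t ht
  refine ⟨y, y', ?_, hy0, hy0'⟩
  rintro rfl
  rcases lt_trichotomy w.length w'.length with hl | hl | hl
  · exact hj' (by rw [← hyj, hy' _ hl]; exact List.getElem_mem _)
  · exact hne (List.ext_getElem hl fun i h1 h2 => by rw [← hy i h1, ← hy' i h2])
  · exact hj (by rw [← hyj', hy _ hl]; exact List.getElem_mem _)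

/-- Two different points start at every state. -/
lemma exists_ne_from (x : A.X) (a : Fin A.N) :
    ∃ y y' : A.X, y ≠ y' ∧ y.1 0 = a ∧ y'.1 0 = a := by
  obtain ⟨j, hp, w, w', hne, hj, hj', hw, hw'⟩ := A.conditionI a
  induction hp using Relation.ReflTransGen.head_induction_on with
  | refl => exact A.exists_ne_of_loops x j w w' hne hj hj' hw hw'
  | head hab _ ih =>
    obtain ⟨y, y', hne, hy, hy'⟩ := ih
    obtain ⟨z, hz, hzy⟩ := A.exists_cons _ y (by rw [hy]; exact hab)
    obtain ⟨z', hz', hzy'⟩ := A.exists_cons _ y' (by rw [hy']; exact hab)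
    exact ⟨z, z', fun e => hne (by rw [← hzy, ← hzy', e]), hz, hz'⟩

/-- Cylinders have more than one point. -/
lemma exists_ne_in_cylinder (x : A.X) (m : ℕ) :
    ∃ y y' : A.X, y ≠ y' ∧ (∀ i < m, y.1 i = x.1 i) ∧ (∀ i < m, y'.1 i = x.1 i) := by
  obtain ⟨y, y', hne, hy, hy'⟩ := A.exists_ne_from x (x.1 m)
  obtain ⟨z, hz, hzy⟩ := A.exists_prefix m x y hy
  obtain ⟨z', hz', hzy'⟩ := A.exists_prefix m x y' hy'
  exact ⟨z, z', fun e => hne (by rw [← hzy, ← hzy', e]), fun i hi => hz i hi.le,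
    fun i hi => hz' i hi.le⟩

/-- The space `X_A` has no isolated points. -/
lemma exists_ne_of_mem_nhds (x : A.X) (U : Set A.X) (hU : U ∈ nhds x) : ∃ y ∈ U, y ≠ x := by
  obtain ⟨m, hm⟩ := A.exists_cylinder_subset hU
  obtain ⟨y, y', hne, hy, hy'⟩ := A.exists_ne_in_cylinder x m
  by_cases h : y = x
  · exact ⟨y', hm _ hy', fun h' => hne (h.trans h'.symm)⟩
  · exact ⟨y, hm _ hy, h⟩

/-- Different powers of the shift differ on every nonempty open set. -/
lemma exists_iterate_ne_of_lt (x : A.X) (U : Set A.X) (hU : U ∈ nhds x) {p q : ℕ} (hpq : p < q) :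
    ∃ y ∈ U, (A.σ)^[p] y ≠ (A.σ)^[q] y := by
  obtain ⟨m, hm⟩ := A.exists_cylinder_subset hU
  obtain ⟨y, y', hne, hy, hy'⟩ := A.exists_ne_in_cylinder x (max m q)
  by_contra! hcon
  -- If the powers agree on `U`, every coordinate from `q` on is copied from an earlier one, so the
  -- first `q` coordinates determine a point of `U`.
  have key : ∀ z ∈ U, ∀ n, q ≤ n → z.1 n = z.1 (n - q + p) := by
    intro z hz n hn
    rw [← A.σ_iterate p z, hcon z hz, A.σ_iterate, Nat.sub_add_cancel hn]
  have hyU : y ∈ U := hm y fun i hi => hy i (hi.trans_le (le_max_left _ _))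
  have hyU' : y' ∈ U := hm y' fun i hi => hy' i (hi.trans_le (le_max_left _ _))
  refine hne (A.ext_coord fun n => ?_)
  induction n using Nat.strong_induction_on with
  | _ n ih =>
    rcases lt_or_ge n (max m q) with h | h
    · rw [hy n h, hy' n h]
    · have hq : q ≤ n := (le_max_right _ _).trans h
      rw [key y hyU n hq, key y' hyU' n hq]
      exact ih _ (by omega)

lemma exists_iterate_ne (x : A.X) (U : Set A.X) (hU : U ∈ nhds x) {p q : ℕ} (hpq : p ≠ q) :
    ∃ y ∈ U, (A.σ)^[p] y ≠ (A.σ)^[q] y := by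
  rcases hpq.lt_or_gt with h | h
  · exact A.exists_iterate_ne_of_lt x U hU h
  · obtain ⟨y, hy, hne⟩ := A.exists_iterate_ne_of_lt x U hU h
    exact ⟨y, hy, hne.symm⟩

/-- Every word of a point can be closed up to a periodic point, by a path of bounded length. -/
lemma exists_periodic_prefix : ∃ R : ℕ, ∀ (x : A.X) (m : ℕ), ∃ (p : A.X) (n : ℕ),
    m < n ∧ n ≤ m + R ∧ (A.σ)^[n] p = p ∧ ∀ i < m, p.1 i = x.1 i := by
  let := Matrix.toQuiver A.mat
  choose p hp using A.irreducible.connected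
  -- One connecting path is fixed for each of the finitely many pairs of states, so the bound
  -- depends on neither `x` nor `m`.
  refine ⟨Finset.univ.sup fun ab : Fin A.N × Fin A.N => (p ab.1 ab.2).length, fun x m => ?_⟩
  obtain ⟨y, hy, hyx⟩ := A.exists_path _ _ (p (x.1 m) (x.1 0)) x rfl
  obtain ⟨z, hz, hzy⟩ := A.exists_prefix m x y hy
  have hr : 0 < (p (x.1 m) (x.1 0)).length := hp _ _
  have hR : (p (x.1 m) (x.1 0)).length ≤
      Finset.univ.sup fun ab : Fin A.N × Fin A.N => (p ab.1 ab.2).length :=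
    Finset.le_sup (f := fun ab : Fin A.N × Fin A.N => (p ab.1 ab.2).length)
      (Finset.mem_univ (x.1 m, x.1 0))
  generalize (p (x.1 m) (x.1 0)).length = r at hyx hr hR
  -- `z` reads `x` up to time `m` and then returns to the first letter of `x`, so its first `m + r`
  -- letters can be repeated periodically.
  have hT : z.1 (m + r) = z.1 0 := by
    rw [hz 0 (Nat.zero_le _)]
    have h1 := A.σ_iterate r y 0
    have h2 := A.σ_iterate m z (0 + r)
    change ((A.σ)^[r] y).1 0 = _ at h1
    rw [hyx] at h1
    rw [hzy] at h2
    rw [h1, h2, zero_add, add_comm]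
  have hstep : ∀ n, A.mat (z.1 (n % (m + r))) (z.1 ((n + 1) % (m + r))) = 1 := by
    intro n
    have hlt : n % (m + r) < m + r := Nat.mod_lt _ (by omega)
    have e : (n + 1) % (m + r) = (n % (m + r) + 1) % (m + r) := by simp
    rw [e]
    rcases Nat.lt_or_ge (n % (m + r) + 1) (m + r) with h | h
    · rw [Nat.mod_eq_of_lt h]; exact z.2 _
    · have h' : n % (m + r) + 1 = m + r := by omega
      have := z.2 (n % (m + r))
      rw [h', hT] at this
      rw [h', Nat.mod_self]; exact this
  refine ⟨⟨fun n => z.1 (n % (m + r)), hstep⟩, m + r, by omega, by omega, ?_, ?_⟩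
  · refine A.ext_coord fun n => ?_
    rw [A.σ_iterate]
    change z.1 _ = z.1 _
    rw [Nat.add_mod_right]
  · intro i hi
    change z.1 _ = _
    rw [Nat.mod_eq_of_lt (by omega), hz i hi.le]

end MarkovShift

/-! ### Birkhoff sums along orbits that meet -/

section BirkhoffSum

variable {X : Type*} {T : X → X} {f : X → ℤ}

/-- Differences of Birkhoff sums along two orbits that meet depend on the lag only. -/
lemma birkhoffSum_sub_eq_of_iterate_eq {u v : X} {a b a' b' : ℕ} (h : T^[a] u = T^[b] v)
    (h' : T^[a'] u = T^[b'] v) (hlag : b + a' = b' + a) :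
    birkhoffSum T f b v - birkhoffSum T f a u = birkhoffSum T f b' v - birkhoffSum T f a' u := by
  wlog haa : a ≤ a' generalizing a b a' b'
  · exact (this h' h hlag.symm (by omega)).symm
  obtain ⟨d, rfl⟩ := Nat.exists_eq_add_of_le haa
  obtain rfl : b' = b + d := by omega
  -- Past the meeting point both sums gain the same `d` terms.
  rw [birkhoffSum_add, birkhoffSum_add, h]
  ring

/-- The sum of length `b + d` can be split after `b` or after `d` terms. -/
lemma birkhoffSum_iterate_sub_comm (w : X) (b d : ℕ) :
    birkhoffSum T f d (T^[b] w) - birkhoffSum T f b (T^[d] w) =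
      birkhoffSum T f d w - birkhoffSum T f b w := by
  have h1 := birkhoffSum_add T f b d w
  have h2 := birkhoffSum_add T f d b w
  rw [add_comm] at h2
  linarith

/-- Concatenation of two meeting pairs of orbits. -/
lemma birkhoffSum_sub_add {u v w : X} {a b c d : ℕ} (h : T^[a] u = T^[b] w)
    (h' : T^[c] v = T^[d] w) :
    (birkhoffSum T f a u - birkhoffSum T f b w) - (birkhoffSum T f c v - birkhoffSum T f d w) =
      birkhoffSum T f (a + d) u - birkhoffSum T f (b + c) v := by
  -- Both pairs are followed to the point of the orbit of `w` at time `b + d`.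
  have := birkhoffSum_iterate_sub_comm (T := T) (f := f) w b d
  rw [birkhoffSum_add, add_comm b c, birkhoffSum_add, h, h']
  linarith

end BirkhoffSum

/-! ### Independence of the choice of `k`, `l`, and functoriality -/

section CocycleSum

variable {A B C : MarkovShift}

lemma cocycleSum_eq (h : A.X → B.X) (k l : C(A.X, ℕ)) (f : C(B.X, ℤ)) (x : A.X) :
    cocycleSum h k l f x =
      birkhoffSum B.σ f (l x) (h x) - birkhoffSum B.σ f (k x) (h (A.σ x)) := rfl

lemma ContinuousMap.eventually_eq_of_discrete {X Y : Type*} [TopologicalSpace X]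
    [TopologicalSpace Y] [DiscreteTopology Y] (f : C(X, Y)) (x : X) :
    ∀ᶠ y in nhds x, f y = f x :=
  f.continuous.continuousAt.eventually (p := fun a => a = f x)
    (IsOpen.mem_nhds (isOpen_discrete {f x}) rfl)

/-- The lag `l - k` of a continuous orbit map is determined by the map. -/
lemma OrbitEq.lag_unique {h : A.X → B.X} (hh : IsOpenMap h) {k l k' l' : C(A.X, ℕ)}
    (H : OrbitEq h k l) (H' : OrbitEq h k' l') (x : A.X) : l x + k' x = l' x + k x := by
  by_contra hne
  -- Near `x` all four functions are constant, and `h` is open, so fixed exponents serve a whole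
  -- neighbourhood of `h x`.
  have hU : {y | ((k y = k x ∧ l y = l x) ∧ k' y = k' x) ∧ l' y = l' x} ∈ nhds x :=
    ((k.eventually_eq_of_discrete x |>.and (l.eventually_eq_of_discrete x)).and
      (k'.eventually_eq_of_discrete x)).and (l'.eventually_eq_of_discrete x)
  obtain ⟨_, ⟨y, ⟨⟨⟨h1, h2⟩, h3⟩, h4⟩, rfl⟩, hy⟩ :=
    B.exists_iterate_ne (h x) _ (hh.image_mem_nhds hU) hne
  apply hy
  have e := H y
  have e' := H' y
  rw [h1, h2] at e
  rw [h3, h4] at e'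
  -- Both powers send `h y` to `σ_B^(k x + k' x) (h (σ_A y))`.
  rw [add_comm, Function.iterate_add_apply, ← e, add_comm, Function.iterate_add_apply, ← e',
    ← Function.iterate_add_apply, ← Function.iterate_add_apply, add_comm]

lemma OrbitEq.cocycleSum_eq {h : A.X → B.X} (hh : IsOpenMap h) {k l k' l' : C(A.X, ℕ)}
    (H : OrbitEq h k l) (H' : OrbitEq h k' l') (f : C(B.X, ℤ)) (x : A.X) :
    cocycleSum h k l f x = cocycleSum h k' l' f x :=
  birkhoffSum_sub_eq_of_iterate_eq (H x) (H' x) (H.lag_unique hh H' x)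

lemma Psi_apply (h : ContOrbitMap A B) (f : C(B.X, ℤ)) (x : A.X) :
    Psi h f x = cocycleSum h.toFun h.k h.l f x := rfl

/-- `Ψ_h` may be computed with any choice of the functions `k`, `l`. -/
lemma Psi_eq_cocycleSum (h : ContOrbitMap A B) {k l : C(A.X, ℕ)} (H : OrbitEq h.toFun k l)
    (f : C(B.X, ℤ)) (x : A.X) : Psi h f x = cocycleSum h.toFun k l f x :=
  h.orbitEq.cocycleSum_eq h.isContOrbitMap.1.isOpenMap H f x

lemma birkhoff_succ (k : C(A.X, ℕ)) (n : ℕ) (x : A.X) :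
    birkhoff k (n + 1) x = birkhoff k n x + k ((A.σ)^[n] x) := Finset.sum_range_succ _ _

/-- Birkhoff sums of `Ψ_h f`. -/
lemma birkhoffSum_Psi (h : ContOrbitMap A B) (f : C(B.X, ℤ)) (n : ℕ) (x : A.X) :
    birkhoffSum A.σ (Psi h f) n x =
      birkhoffSum B.σ f (birkhoff h.l n x) (h.toFun x) -
        birkhoffSum B.σ f (birkhoff h.k n x) (h.toFun ((A.σ)^[n] x)) := by
  induction n with
  | zero => simp [birkhoff]
  | succ n ih =>
    rw [birkhoffSum_succ, ih, Psi_apply, _root_.cocycleSum_eq, birkhoff_succ, birkhoff_succ,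
      ← Function.iterate_succ_apply' A.σ]
    have e1 := h.orbitEq.iterate n x
    have e2 := h.orbitEq ((A.σ)^[n] x)
    rw [← Function.iterate_succ_apply' A.σ] at e2
    -- The first `n` steps and the last one are joined at `h (σ_A^n x)`.
    rw [← birkhoffSum_sub_add e1.symm e2]
    ring

/-- The functions `k`, `l` for a composition. -/
lemma ContOrbitMap.exists_orbitEq_comp (g : ContOrbitMap B C) (h : ContOrbitMap A B) :
    ∃ k l : C(A.X, ℕ), OrbitEq (g.comp h).toFun k l ∧ ∀ x,
      l x = birkhoff g.l (h.l x) (h.toFun x) + birkhoff g.k (h.k x) (h.toFun (A.σ x)) ∧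
      k x = birkhoff g.k (h.l x) (h.toFun x) + birkhoff g.l (h.k x) (h.toFun (A.σ x)) := by
  have c1 : Continuous h.toFun := h.continuous
  have c2 : Continuous fun x => h.toFun (A.σ x) := c1.comp A.σ.continuous
  refine ⟨⟨fun x => birkhoff g.k (h.l x) (h.toFun x) + birkhoff g.l (h.k x) (h.toFun (A.σ x)), ?_⟩,
    ⟨fun x => birkhoff g.l (h.l x) (h.toFun x) + birkhoff g.k (h.k x) (h.toFun (A.σ x)), ?_⟩, ?_,
    fun x => ⟨rfl, rfl⟩⟩
  · exact (continuous_iterate_nat h.l (fun n x => birkhoff g.k n (h.toFun x))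
        fun n => (continuous_birkhoff g.k n).comp c1).add
      (continuous_iterate_nat h.k (fun n x => birkhoff g.l n (h.toFun (A.σ x)))
        fun n => (continuous_birkhoff g.l n).comp c2)
  · exact (continuous_iterate_nat h.l (fun n x => birkhoff g.l n (h.toFun x))
        fun n => (continuous_birkhoff g.l n).comp c1).add
      (continuous_iterate_nat h.k (fun n x => birkhoff g.k n (h.toFun (A.σ x)))
        fun n => (continuous_birkhoff g.k n).comp c2)
  · intro x
    have e1 := g.orbitEq.iterate (h.l x) (h.toFun x)
    have e2 := g.orbitEq.iterate (h.k x) (h.toFun (A.σ x))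
    rw [h.orbitEq x] at e2
    simp only [ContinuousMap.coe_mk, ContOrbitMap.comp, Function.comp_apply]
    rw [Function.iterate_add_apply, ← e2, ← Function.iterate_add_apply, add_comm,
      Function.iterate_add_apply, e1, ← Function.iterate_add_apply, add_comm]

/-- Functoriality of `h ↦ Ψ_h`. -/
lemma Psi_Psi (h : ContOrbitMap A B) (g : ContOrbitMap B C) (f : C(C.X, ℤ)) :
    Psi h (Psi g f) = Psi (g.comp h) f := by
  ext x
  obtain ⟨k, l, H, hkl⟩ := g.exists_orbitEq_comp h
  rw [Psi_eq_cocycleSum _ H, Psi_apply, cocycleSum_eq, cocycleSum_eq, (hkl x).1, (hkl x).2,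
    birkhoffSum_Psi, birkhoffSum_Psi]
  have e1 := g.orbitEq.iterate (h.l x) (h.toFun x)
  have e2 := g.orbitEq.iterate (h.k x) (h.toFun (A.σ x))
  -- The joint is the `g`-image of the point where the orbits of `h x` and `h (σ_A x)` meet.
  rw [h.orbitEq x] at e2 ⊢
  exact birkhoffSum_sub_add e1.symm e2.symm

lemma Psi_id (f : C(A.X, ℤ)) : Psi (ContOrbitMap.id A) f = f := by
  ext x
  have H : OrbitEq (ContOrbitMap.id A).toFun (ContinuousMap.const _ 0) (ContinuousMap.const _ 1) :=
    fun _ => rfl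
  rw [Psi_eq_cocycleSum _ H]
  simp [cocycleSum, ContOrbitMap.id]

lemma PsiBar_mk (h : ContOrbitMap A B) (f : C(B.X, ℤ)) :
    PsiBar h (H.mk B f) = H.mk A (Psi h f) := rfl

lemma PsiBar_PsiBar (h : ContOrbitMap A B) (g : ContOrbitMap B C) (u : H C) :
    PsiBar h (PsiBar g u) = PsiBar (g.comp h) u := by
  obtain ⟨f, rfl⟩ := QuotientAddGroup.mk'_surjective _ u
  rw [PsiBar_mk, PsiBar_mk, PsiBar_mk, Psi_Psi]

lemma PsiBar_id (u : H A) : PsiBar (ContOrbitMap.id A) u = u := by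
  obtain ⟨f, rfl⟩ := QuotientAddGroup.mk'_surjective _ u
  rw [PsiBar_mk, Psi_id]

end CocycleSum

/-! ### Positive lag on periodic orbits and nonnegative representatives -/

section Positivity

variable {A B : MarkovShift}

/-- The lag of a continuous orbit map along a periodic orbit is positive: otherwise `h σ^n h⁻¹`
would not move points away from `h x`, and `x` would be isolated. -/
lemma ContOrbitMap.birkhoff_k_lt_birkhoff_l (h : ContOrbitMap A B) {x : A.X} {n : ℕ} (hn : 0 < n)
    (hx : (A.σ)^[n] x = x) : birkhoff h.k n x < birkhoff h.l n x := by
  by_contra! hle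
  have hcσ : Continuous (A.σ)^[n] := A.σ.continuous.iterate n
  obtain ⟨W₀, hW₀, hinj⟩ : ∃ W₀ ∈ nhds x, Set.InjOn h.toFun W₀ :=
    h.isContOrbitMap.1.isLocallyInjective x |>.imp fun U hU => ⟨hU.1.mem_nhds hU.2.1, hU.2.2⟩
  have e1 : ∀ᶠ y in nhds x, birkhoff h.k n y = birkhoff h.k n x :=
    ContinuousMap.eventually_eq_of_discrete ⟨_, continuous_birkhoff h.k n⟩ x
  have e2 : ∀ᶠ y in nhds x, birkhoff h.l n y = birkhoff h.l n x :=
    ContinuousMap.eventually_eq_of_discrete ⟨_, continuous_birkhoff h.l n⟩ x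
  have e3 : ∀ᶠ y in nhds x, (A.σ)^[n] y ∈ W₀ :=
    hcσ.continuousAt.eventually (by rw [hx]; exact hW₀)
  have e4 : ∀ᶠ y in nhds x, ∀ i < birkhoff h.k n x,
      (h.toFun ((A.σ)^[n] y)).1 i = (h.toFun x).1 i := by
    have := (h.continuous.comp hcσ).continuousAt.eventually
      (B.eventually_cylinder ((h.toFun ∘ (A.σ)^[n]) x) (birkhoff h.k n x))
    simpa only [Function.comp_apply, hx] using this
  have e5 := A.eventually_cylinder x n
  have hperiod := h.orbitEq.iterate n x
  rw [hx] at hperiod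
  set K := birkhoff h.k n x
  set L := birkhoff h.l n x
  obtain ⟨W, hW, hWx⟩ : ∃ W ∈ nhds x, ∀ y ∈ W, y ∈ W₀ ∧ birkhoff h.k n y = K ∧
      birkhoff h.l n y = L ∧ (A.σ)^[n] y ∈ W₀ ∧
      (∀ i < K, (h.toFun ((A.σ)^[n] y)).1 i = (h.toFun x).1 i) ∧ ∀ i < n, y.1 i = x.1 i :=
    ⟨_, (Filter.Eventually.and hW₀ (e1.and (e2.and (e3.and (e4.and e5))))), fun y hy => hy⟩
  -- The `N`-cylinder around `h x` lies in `h(W)`. Its preimage in `W` turns out to be invariant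
  -- under `σ_A^n`.
  obtain ⟨N, hN⟩ := B.exists_cylinder_subset (h.isContOrbitMap.1.isOpenMap.image_mem_nhds hW)
  have hinv : ∀ y, y ∈ W ∧ (∀ i < N, (h.toFun y).1 i = (h.toFun x).1 i) →
      (A.σ)^[n] y ∈ W ∧ ∀ i < N, (h.toFun ((A.σ)^[n] y)).1 i = (h.toFun x).1 i := by
    rintro y ⟨hyW, hyN⟩
    obtain ⟨-, hk, hl, hσ, hK, -⟩ := hWx y hyW
    have horb := h.orbitEq.iterate n y
    rw [hk, hl] at horb
    have hcyl : ∀ i < N, (h.toFun ((A.σ)^[n] y)).1 i = (h.toFun x).1 i := by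
      intro i hi
      rcases lt_or_ge i K with hiK | hiK
      · exact hK i hiK
      · obtain ⟨j, rfl⟩ := Nat.exists_eq_add_of_le' hiK
        -- Coordinate `j + K` of `h (σ_A^n y)` is coordinate `j + L` of `h y`; as `L ≤ K`, it still
        -- lies within the first `N`.
        rw [← B.σ_iterate, ← B.σ_iterate, horb, hperiod, B.σ_iterate, B.σ_iterate]
        exact hyN _ (by omega)
    obtain ⟨y', hy', he⟩ := hN _ hcyl
    -- Injectivity of `h` on `W₀` identifies `σ_A^n y` with the preimage `y'` in `W`.
    exact ⟨hinj (hWx y' hy').1 hσ he ▸ hy', hcyl⟩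
  have hU : {y | y ∈ W ∧ ∀ i < N, (h.toFun y).1 i = (h.toFun x).1 i} ∈ nhds x :=
    Filter.Eventually.and hW
      (h.continuous.continuousAt.eventually (B.eventually_cylinder (h.toFun x) N))
  obtain ⟨y, hy, hne⟩ := A.exists_ne_of_mem_nhds x _ hU
  have hiter : ∀ r, (A.σ)^[n * r] y ∈ W ∧
      ∀ i < N, (h.toFun ((A.σ)^[n * r] y)).1 i = (h.toFun x).1 i := by
    intro r
    induction r with
    | zero => exact hy
    | succ r ih =>
      rw [Nat.mul_succ, add_comm, Function.iterate_add_apply]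
      exact hinv _ ih
  -- Every `σ_A^(n r) y` stays in `W` and so starts with the first `n` letters of `x`: `y` and `x`
  -- agree block by block.
  refine hne (A.ext_coord fun i => ?_)
  have hxr : (A.σ)^[n * (i / n)] x = x := by
    rw [Function.iterate_mul]; exact Function.iterate_fixed hx _
  have := (hWx _ (hiter (i / n)).1).2.2.2.2.2 (i % n) (Nat.mod_lt _ hn)
  rw [← hxr] at this
  rwa [A.σ_iterate, A.σ_iterate, Nat.mod_add_div] at this

/-- The periodic sums of `Ψ_h f` are nonnegative if `f` is. -/
lemma birkhoffSum_Psi_nonneg (h : ContOrbitMap A B) {f : C(B.X, ℤ)} (hf : 0 ≤ f) {x : A.X} {n : ℕ}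
    (hn : 0 < n) (hx : (A.σ)^[n] x = x) : 0 ≤ birkhoffSum A.σ (Psi h f) n x := by
  rw [birkhoffSum_Psi, hx]
  -- Both sums start at `h x`, so only the extra terms of the longer one survive.
  obtain ⟨d, hd⟩ := Nat.exists_eq_add_of_lt (h.birkhoff_k_lt_birkhoff_l hn hx)
  rw [hd, add_assoc, birkhoffSum_add, add_sub_cancel_left]
  exact Finset.sum_nonneg fun i _ => hf _

/-- Birkhoff sums of a function of finitely many coordinates agree on points with a long common
prefix. -/
lemma MarkovShift.birkhoffSum_congr {F : A.X → ℤ} {m : ℕ}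
    (hF : ∀ x y : A.X, (∀ i < m, x.1 i = y.1 i) → F x = F y) {n : ℕ} {x y : A.X}
    (hxy : ∀ i < n + m, x.1 i = y.1 i) : birkhoffSum A.σ F n x = birkhoffSum A.σ F n y := by
  refine Finset.sum_congr rfl fun i hi => hF _ _ fun j hj => ?_
  have := Finset.mem_range.1 hi
  rw [A.σ_iterate, A.σ_iterate]
  exact hxy _ (by omega)

/-- A bound in `ℕ` is nonnegative, so it can be multiplied by an upper bound for a number of terms.
-/
lemma ContinuousMap.exists_le_of_compact {X : Type*} [TopologicalSpace X] [CompactSpace X]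
    (F : C(X, ℤ)) : ∃ c : ℕ, ∀ x, F x ≤ c := by
  obtain ⟨c, hc⟩ := (isCompact_range F.continuous).bddAbove
  exact ⟨c.toNat, fun x => (hc ⟨x, rfl⟩).trans (Int.self_le_toNat c)⟩

/-- Birkhoff sums are bounded below if the periodic sums are nonnegative. -/
lemma MarkovShift.exists_le_birkhoffSum (F : C(A.X, ℤ))
    (hper : ∀ (x : A.X) (n : ℕ), 0 < n → (A.σ)^[n] x = x → 0 ≤ birkhoffSum A.σ F n x) :
    ∃ c : ℤ, ∀ (n : ℕ) (x : A.X), c ≤ birkhoffSum A.σ F n x := by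
  obtain ⟨m, hm⟩ := A.exists_coord_dependence F
  obtain ⟨R, hR⟩ := A.exists_periodic_prefix
  obtain ⟨b, hb⟩ := F.exists_le_of_compact
  -- At most `m + R` terms of the periodic sum follow the first `n`, each at most `b`.
  refine ⟨-((m + R : ℕ) * b : ℤ), fun n x => ?_⟩
  obtain ⟨p, r, h1, h2, hp, hpx⟩ := hR x (n + m)
  have h0 := hper p r (by omega) hp
  obtain ⟨s, rfl⟩ := Nat.exists_eq_add_of_le (show n ≤ r by omega)
  rw [birkhoffSum_add, MarkovShift.birkhoffSum_congr hm hpx] at h0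
  have h3 : birkhoffSum A.σ F s ((A.σ)^[n] p) ≤ (s : ℤ) * b := by
    refine (Finset.sum_le_card_nsmul _ _ (b : ℤ) fun i _ => hb _).trans ?_
    simp
  have h4 : (s : ℤ) * b ≤ (m + R : ℕ) * b := by
    have : s ≤ m + R := by omega
    gcongr
  linarith

/-- A function whose periodic sums are nonnegative is cohomologous to a nonnegative function. -/
lemma MarkovShift.exists_nonneg_add_coboundary (F : C(A.X, ℤ))
    (hper : ∀ (x : A.X) (n : ℕ), 0 < n → (A.σ)^[n] x = x → 0 ≤ birkhoffSum A.σ F n x) :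
    ∃ ξ : C(A.X, ℤ), 0 ≤ F + coboundary A ξ := by
  obtain ⟨c, hc⟩ := MarkovShift.exists_le_birkhoffSum F hper
  obtain ⟨m, hm⟩ := A.exists_coord_dependence F
  -- The transfer function at `x` is the infimum of the Birkhoff sums over all finite histories of
  -- `x`.
  let S : A.X → Set ℤ := fun x => {a | ∃ n y, (A.σ)^[n] y = x ∧ birkhoffSum A.σ F n y = a}
  have hbdd : ∀ x, BddBelow (S x) := by
    intro x
    refine ⟨c, ?_⟩
    rintro _ ⟨n, y, -, rfl⟩
    exact hc n y
  have hne : ∀ x, (S x).Nonempty := fun x => ⟨_, 0, x, rfl, rfl⟩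
  -- With `m + 1`, coordinate `0` is shared even if `m = 0`, so a history of `x` can be glued to
  -- `x'`.
  have hsub : ∀ x x' : A.X, (∀ i < m + 1, x.1 i = x'.1 i) → S x ⊆ S x' := by
    rintro x x' hxx _ ⟨n, y, rfl, rfl⟩
    have h0 : x'.1 0 = y.1 n := by
      rw [← hxx 0 (Nat.succ_pos m), A.σ_iterate, zero_add]
    obtain ⟨z, hz, hzx⟩ := A.exists_prefix n y x' h0
    refine ⟨n, z, hzx, MarkovShift.birkhoffSum_congr hm fun i hi => ?_⟩
    rcases Nat.lt_or_ge i n with h | h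
    · exact hz i h.le
    · obtain ⟨j, rfl⟩ := Nat.exists_eq_add_of_le' h
      rw [← A.σ_iterate, ← A.σ_iterate, hzx]
      exact (hxx j (by omega)).symm
  have hcont : Continuous fun x => sInf (S x) :=
    A.continuous_of_coord_dependence _ (m + 1) fun x y hxy => by
      rw [(hsub x y hxy).antisymm (hsub y x fun i hi => (hxy i hi).symm)]
  refine ⟨⟨_, hcont⟩, fun x => ?_⟩
  change (0 : ℤ) ≤ F x + (sInf (S x) - sInf (S (A.σ x)))
  -- The infimum of integers is attained; an optimal history of `x`, prolonged by one step, is a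
  -- history of `σ_A x`.
  obtain ⟨n, y, rfl, hy⟩ := Int.csInf_mem (hne x) (hbdd x)
  have : sInf (S (A.σ ((A.σ)^[n] y))) ≤ birkhoffSum A.σ F (n + 1) y :=
    csInf_le (hbdd _) ⟨n + 1, y, Function.iterate_succ_apply' _ _ _, rfl⟩
  rw [birkhoffSum_succ] at this
  linarith

/-- `Ψ̄_h` preserves the positive cones. -/
lemma psiBarPositive : PsiBarPositive := by
  rintro A B h _ ⟨f, hf, rfl⟩
  obtain ⟨ξ, hξ⟩ := MarkovShift.exists_nonneg_add_coboundary (Psi h f)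
    fun x n hn hx => birkhoffSum_Psi_nonneg h hf hn hx
  refine ⟨_, hξ, ?_⟩
  rw [map_add, PsiBar_mk, add_eq_left]
  exact (QuotientAddGroup.eq_zero_iff _).2 ⟨ξ, rfl⟩

end Positivity

/-! ### The functors to ordered abelian groups -/

section Functor

lemma psiHom_id (hpos : PsiBarPositive) (A : MarkovShift) :
    psiHom hpos (ContOrbitMap.id A) = 𝟙 (orderedH A) :=
  OrdAb.Hom.ext (AddMonoidHom.ext fun u => PsiBar_id u)

lemma psiHom_comp (hpos : PsiBarPositive) {A B C : MarkovShift} (h : ContOrbitMap A B)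
    (g : ContOrbitMap B C) : psiHom hpos (g.comp h) = psiHom hpos g ≫ psiHom hpos h :=
  OrdAb.Hom.ext (AddMonoidHom.ext fun u => (PsiBar_PsiBar h g u).symm)

/-- The isomorphism of ordered groups induced by a continuous orbit homeomorphism. -/
noncomputable def psiIso (hpos : PsiBarPositive) {A B : MarkovShift} (e : A.X ≃ₜ B.X)
    (he : IsContOrbitMap e) (he' : IsContOrbitMap e.symm) : orderedH B ≅ orderedH A where
  hom := psiHom hpos ⟨e, he⟩
  inv := psiHom hpos ⟨e.symm, he'⟩
  hom_inv_id := by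
    rw [← psiHom_comp, ← psiHom_id]
    -- The functions `k`, `l` are not data of a morphism, so equality of the underlying maps
    -- suffices.
    exact congrArg _ (ContOrbitMap.ext (funext e.apply_symm_apply))
  inv_hom_id := by
    rw [← psiHom_comp, ← psiHom_id]
    exact congrArg _ (ContOrbitMap.ext (funext e.symm_apply_apply))

end Functor

theorem theorem3 :
    (∀ (A B C : MarkovShift) (h : ContOrbitMap A B) (g : ContOrbitMap B C),
      -- `Ψ_h` does not depend on the choice of the functions `k`, `l`
      (∀ k l : C(A.X, ℕ), OrbitEq h.toFun k l →
        ∀ (f : C(B.X, ℤ)) (x : A.X), Psi h f x = cocycleSum h.toFun k l f x) ∧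
      -- (i)
      (∀ f : C(C.X, ℤ), Psi h (Psi g f) = Psi (g.comp h) f) ∧
      -- (ii)
      (cobdy B).map (Psi h) ≤ cobdy A ∧ (cobdy C).map (Psi g) ≤ cobdy B ∧
      -- (iii)
      (∀ u ∈ HPlus B, PsiBar h u ∈ HPlus A) ∧ (∀ u ∈ HPlus C, PsiBar g u ∈ HPlus B) ∧
      (∀ u : H C, PsiBar h (PsiBar g u) = PsiBar (g.comp h) u)) ∧
    ∃ hpos : PsiBarPositive,
      -- contravariant functor on Markov shifts
      (∃ F : MarkovShiftᵒᵖ ⥤ OrdAb, F.toPrefunctor = psiCorrespondence hpos) ∧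
      -- continuous orbit homeomorphisms induce isomorphisms of ordered groups
      (∀ (A B : MarkovShift) (e : A.X ≃ₜ B.X) (he : IsContOrbitMap e)
        (he' : IsContOrbitMap e.symm), ∃ i : orderedH B ≅ orderedH A,
          i.hom = psiHom hpos ⟨e, he⟩ ∧ i.inv = psiHom hpos ⟨e.symm, he'⟩) ∧
      -- contravariant functor on continuous orbit equivalence classes
      (∃ F : COEClassᵒᵖ ⥤ OrdAb, F.toPrefunctor = psiClassCorrespondence hpos ∧
        ∀ A : MarkovShift, Nonempty (F.obj (Opposite.op (COEClass.mk A)) ≅ orderedH A)) := by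
  refine ⟨fun A B C h g => ⟨fun k l H => Psi_eq_cocycleSum h H, Psi_Psi h g,
    AddSubgroup.map_le_iff_le_comap.2 (cobdy_le_comap_Psi h),
    AddSubgroup.map_le_iff_le_comap.2 (cobdy_le_comap_Psi g),
    psiBarPositive h, psiBarPositive g, PsiBar_PsiBar h g⟩, psiBarPositive, ?_, ?_, ?_⟩
  · exact ⟨{ obj := (psiCorrespondence psiBarPositive).obj
             map := (psiCorrespondence psiBarPositive).map
             map_id := fun A => psiHom_id _ A.unop
             map_comp := fun h g => psiHom_comp _ g.unop h.unop }, rfl⟩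
  · exact fun A B e he he' => ⟨psiIso psiBarPositive e he he', rfl, rfl⟩
  · refine ⟨{ obj := (psiClassCorrespondence psiBarPositive).obj
              map := (psiClassCorrespondence psiBarPositive).map
              map_id := fun c => psiHom_id _ c.unop.rep
              map_comp := fun h g => psiHom_comp _ g.unop h.unop }, rfl, fun A => ?_⟩
    -- The chosen representative is only equivalent to `A`, hence an isomorphism instead of an
    -- equality.
    obtain ⟨e, he, he'⟩ : ContOrbitEquiv (COEClass.mk A).rep A :=
      Quotient.exact (Quotient.out_eq (COEClass.mk A))
    exact ⟨(psiIso psiBarPositive e he he').symm⟩
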